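/- For a group $B$, subgroups $H,K\le B$ and an isomorphism $\phi:H\to K$, let $A=\langle B,t\mid t^{-1}ht=\phi(h)\ (h\in H)\rangle$ be the corresponding HNN extension, with base group $B$, associated (amalgamated) subgroups $H$ and $K=\phi(H)$, and stable letter $t$. It is called ascending if $H=B$ or $\phi(H)=B$, and non-ascending otherwise. Theorem. For $i=1,2$ let $A_i=\langle B_i,t_i\mid t_i^{-1}ht_i=\phi_i(h)\ (h\in H_i)\rangle$ be a non-ascending HNN extension whose base group $B_i$ is finitely presented and whose associated subgroup $H_i$ (equivalently $\phi_i(H_i)$) is finitely generated. Let $Q=\langle t\mid\ \rangle$ be the infinite cyclic group and let $q_i:A_i\to Q$ be the homomorphism that sends $t_i$ to $t$ and every element of $B_i$ to $1$. Then the fibre product $$G=\{(a_1,a_2)\in A_1\times A_2 \mid q_1(a_1)=q_2(a_2)\}$$ is finitely generated but not finitely presented. -/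

import Mathlib

namespace FibreHNN

section Basic

variable {B : Type*} [Group B] {H K : Subgroup B}

/-- The HNN extension `⟨B, t ∣ t⁻¹ h t = φ h (h ∈ H)⟩` with base `B`, associated subgroups `H` and
`K = φ(H)`, and stable letter `HNNExtension.t`. (Mathlib's `HNNExtension` has `t a t⁻¹ = ψ a`, so it
is applied to `ψ = φ⁻¹ : K ≃* H`; see `inv_t_mul_of_mul_t` below.) -/
abbrev HNN (φ : H ≃* K) : Type _ := HNNExtension B K H φ.symm

theorem inv_t_mul_of_mul_t (φ : H ≃* K) (h : H) :
    (HNNExtension.t : HNN φ)⁻¹ * HNNExtension.of (h : B) * HNNExtension.t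
      = HNNExtension.of (φ h : B) :=
  (HNNExtension.equiv_symm_eq_conj (φ := φ.symm) h).symm

/-- The HNN extension determined by `φ : H ≃* K` is ascending if `H` or `K = φ(H)` is the whole
base group. -/
def IsAscending (_φ : H ≃* K) : Prop := H = ⊤ ∨ K = ⊤

/-- The homomorphism from an HNN extension to the infinite cyclic group `Multiplicative ℤ` that
kills the base and sends the stable letter to the generator. -/
def toCyclic (φ : H ≃* K) : HNN φ →* Multiplicative ℤ :=
  HNNExtension.lift 1 (Multiplicative.ofAdd 1) (by simp)

@[simp]
theorem toCyclic_of (φ : H ≃* K) (b : B) : toCyclic φ (HNNExtension.of b) = 1 := by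
  simp [toCyclic]

@[simp]
theorem toCyclic_t (φ : H ≃* K) : toCyclic φ HNNExtension.t = Multiplicative.ofAdd 1 := by
  simp [toCyclic]

end Basic

/-- The fibre product `{(x, y) ∣ p x = q y}` of two homomorphisms to the same group, as a subgroup
of the direct product. -/
def fibreProduct {G₁ G₂ Q : Type*} [Group G₁] [Group G₂] [Group Q] (p : G₁ →* Q) (q : G₂ →* Q) :
    Subgroup (G₁ × G₂) :=
  (p.comp (MonoidHom.fst G₁ G₂)).eqLocus (q.comp (MonoidHom.snd G₁ G₂))

theorem mem_fibreProduct {G₁ G₂ Q : Type*} [Group G₁] [Group G₂] [Group Q] {p : G₁ →* Q}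
    {q : G₂ →* Q} {x : G₁ × G₂} : x ∈ fibreProduct p q ↔ p x.1 = q x.2 :=
  Iff.rfl

end FibreHNN

/-! The free product `A₁ * A₂` is finitely generated and maps onto `G`, so `G` is finitely
generated. The kernel is normally generated by `t₁ t₂⁻¹` and the commutators of `B₁` with `t₂ ^ k B₂
t₂ ^ (-k)`, `k ∈ ℤ`. Filter these relators by `k ≤ n`. If `G` were finitely presented, one stage
would normally generate the whole kernel (`exists_ker_le_normalClosure`). No stage does. Let `E ≤
A₁` be generated by the `t ^ j B₁ t ^ (-j)` and `F ≤ A₂` by the `t ^ (-j) B₂ t ^ j`, `j ≥ 0`.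
Conjugation by `t` and by `t⁻¹` gives injections `σ` of `E` and `τ` of `F`, and an HNN extension of
`E × F` has a letter `s` carrying `(e, τ f)` to `(σ e, f)`. Both `A₁` and `A₂` map there with `t ↦
s`, and the commutators with `k ≤ 0` die. Being non-ascending makes `σ` and `τ` miss base elements,
and Britton's lemma then shows that some commutator with `k = 1` survives. A conjugation moves the
threshold from `0` to `n`. -/

namespace HNNExtension

/-! ### Ray subgroups and heights of normal words -/

variable {G : Type*} [Group G] {A B : Subgroup G} (φ : A ≃* B)

/-- The subgroup generated by the conjugates `t ^ (u * j) * G * t ^ (-(u * j))`, `j : ℕ`, of the base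
group along the ray of direction `u`. -/
def raySubgroup (u : ℤˣ) : Subgroup (HNNExtension G A B φ) :=
  Subgroup.closure {x | ∃ (j : ℕ) (g : G),
    x = (t ^ (u : ℤ)) ^ j * of g * ((t ^ (u : ℤ)) ^ j)⁻¹}

theorem of_mem_raySubgroup (u : ℤˣ) (g : G) : of g ∈ raySubgroup φ u :=
  Subgroup.subset_closure ⟨0, g, by simp⟩

theorem conj_mem_raySubgroup (u : ℤˣ) {x : HNNExtension G A B φ} (hx : x ∈ raySubgroup φ u) :
    MulAut.conj (t ^ (u : ℤ)) x ∈ raySubgroup φ u := by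
  suffices raySubgroup φ u ≤
      (raySubgroup φ u).comap (MulAut.conj (t ^ (u : ℤ))).toMonoidHom from this hx
  refine (Subgroup.closure_le _).2 ?_
  rintro _ ⟨j, g, rfl⟩
  refine Subgroup.subset_closure ⟨j + 1, g, ?_⟩
  change t ^ (u : ℤ) * _ * (t ^ (u : ℤ))⁻¹ = _
  simp [pow_succ', mul_assoc]

/-- Conjugation by `t ^ u`, as an endomorphism of `raySubgroup φ u`. -/
def rayShift (u : ℤˣ) : raySubgroup φ u →* raySubgroup φ u :=
  ((MulAut.conj (t ^ (u : ℤ))).toMonoidHom.comp (raySubgroup φ u).subtype).codRestrict _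
    fun x => conj_mem_raySubgroup φ u x.2

@[simp]
theorem coe_rayShift (u : ℤˣ) (x : raySubgroup φ u) :
    (rayShift φ u x : HNNExtension G A B φ) =
      t ^ (u : ℤ) * (x : HNNExtension G A B φ) * (t ^ (u : ℤ))⁻¹ := rfl

theorem rayShift_injective (u : ℤˣ) : Function.Injective (rayShift φ u) := by
  intro x y h
  exact Subtype.ext (by
    simpa only [coe_rayShift, mul_left_inj, mul_right_inj] using congrArg Subtype.val h)

/-- The inclusion of the base group in `raySubgroup φ u`. -/
def rayOf (u : ℤˣ) : G →* raySubgroup φ u :=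
  of.codRestrict _ (of_mem_raySubgroup φ u)

@[simp]
theorem coe_rayOf (u : ℤˣ) (g : G) : (rayOf φ u g : HNNExtension G A B φ) = of g := rfl

open NormalWord

/-- All nonempty prefixes of a list of signed letters have nonnegative height, if the height
starts at `h` and is measured in the direction `u`. -/
def PrefixNonneg (u : ℤˣ) : ℤ → List (ℤˣ × G) → Prop
  | _, [] => True
  | h, a :: l => 0 ≤ h + u * a.1 ∧ PrefixNonneg u (h + u * a.1) l

variable {φ} in
theorem PrefixNonneg.of_smul {d : TransversalPair G A B} {u : ℤˣ} {h : ℤ} {w : NormalWord d}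
    (hw : PrefixNonneg u h w.toList) (g : G) :
    PrefixNonneg u h ((of g : HNNExtension G A B φ) • w).toList := by
  rwa [of_smul_eq_smul, group_smul_toList]

-- A letter put in front either cancels the first letter or adds a prefix of final height `h`; the
-- later prefixes keep their heights once the starting height is moved to `h - u * v`.
variable {φ} in
theorem PrefixNonneg.t_zpow_smul {d : TransversalPair G A B} {u : ℤˣ} {h : ℤ} (hh : 0 ≤ h)
    {w : NormalWord d} (hw : PrefixNonneg u h w.toList) (v : ℤˣ) :
    PrefixNonneg u (h - u * v) ((t ^ (v : ℤ) : HNNExtension G A B φ) • w).toList := by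
  rw [t_pow_smul_eq_unitsSMul, unitsSMul]
  split_ifs with hcan
  · cases w using consRecOn with
    | ofGroup => simp [Cancels] at hcan
    | cons g v' w h1 h2 =>
      obtain rfl : v' = -v := by simpa using hcan.2
      have := hw.2
      simpa [unitsSMulWithCancel, sub_eq_add_neg] using this
  · simpa [PrefixNonneg, hh] using hw

variable {φ} in
theorem prefixNonneg_conj_smul {d : TransversalPair G A B} {u : ℤˣ} {w : NormalWord d}
    (hw : PrefixNonneg u 0 w.toList) (j : ℕ) (g : G) :
    PrefixNonneg u 0
      (((t ^ (u : ℤ)) ^ j * of g * ((t ^ (u : ℤ)) ^ j)⁻¹ : HNNExtension G A B φ) • w).toList := by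
  have hu : (u : ℤ) * u = 1 := by rw [← Units.val_mul, Int.units_mul_self, Units.val_one]
  -- Acting by `(t ^ u) ^ (-j)` raises the starting height from `0` to `j`, and acting by `(t ^ u) ^
  -- j` brings it back, so it is never negative.
  have down : ∀ (j : ℕ) (w : NormalWord d), PrefixNonneg u 0 w.toList →
      PrefixNonneg u j ((((t ^ (u : ℤ)) ^ j)⁻¹ : HNNExtension G A B φ) • w).toList := by
    intro j
    induction j with
    | zero => simp
    | succ j ih =>
      intro w hw
      have := (ih w hw).t_zpow_smul (φ := φ) (by positivity) (-u)
      rw [pow_succ, mul_inv_rev, mul_smul]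
      simpa [hu, sub_eq_add_neg] using this
  have up : ∀ (j : ℕ) (w : NormalWord d), PrefixNonneg u j w.toList →
      PrefixNonneg u 0 (((t ^ (u : ℤ)) ^ j : HNNExtension G A B φ) • w).toList := by
    intro j
    induction j with
    | zero => simp
    | succ j ih =>
      intro w hw
      have := hw.t_zpow_smul (φ := φ) (by positivity) u
      rw [pow_succ, mul_smul]
      exact ih _ (by simpa [hu] using this)
  rw [mul_smul, mul_smul]
  exact up j _ ((down j w hw).of_smul g)

theorem prefixNonneg_of_mem_raySubgroup {d : TransversalPair G A B} {u : ℤˣ}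
    {x : HNNExtension G A B φ} (hx : x ∈ raySubgroup φ u) {w : NormalWord d}
    (hw : PrefixNonneg u 0 w.toList) : PrefixNonneg u 0 (x • w).toList := by
  induction hx using Subgroup.closure_induction'' generalizing w with
  | mem x hx =>
    obtain ⟨j, g, rfl⟩ := hx
    exact prefixNonneg_conj_smul hw j g
  | inv_mem x hx =>
    obtain ⟨j, g, rfl⟩ := hx
    have := prefixNonneg_conj_smul (φ := φ) hw j g⁻¹
    simpa [mul_assoc] using this
  | one => simpa using hw
  | mul x y _ _ hx hy =>
    rw [mul_smul]
    exact hx (hy hw)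

/-- If the base element `g` lies in the shift of `raySubgroup φ u`, it lies in the associated
subgroup of the corresponding edge. -/
theorem mem_toSubgroup_of_mem_range_rayShift {u : ℤˣ} {g : G}
    (hg : rayOf φ u g ∈ (rayShift φ u).range) : g ∈ toSubgroup A B (-u) := by
  obtain ⟨d⟩ := TransversalPair.nonempty G A B
  obtain ⟨x, hx⟩ := hg
  have hx : (x : HNNExtension G A B φ) = (t ^ (u : ℤ))⁻¹ * of g * t ^ (u : ℤ) := by
    have := congrArg Subtype.val hx
    rw [coe_rayShift, coe_rayOf] at this
    rw [← this]
    group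
  by_contra hgu
  -- If `g` is outside the edge subgroup, `t ^ (-u) g t ^ u` is reduced. Reduced words for one
  -- element have the same signs, so its normal form first steps to height `-1`, which is impossible
  -- in the ray subgroup.
  let w : NormalWord.ReducedWord G A B := ⟨1, [(-u, g), (u, 1)], by simp [hgu]⟩
  have hw : w.prod φ = x := by
    simp [w, ReducedWord.prod, hx, mul_assoc]
  have key := prefixNonneg_of_mem_raySubgroup φ x.2 (w := (empty : NormalWord d)) trivial
  have hsign := (ReducedWord.map_fst_eq_and_of_prod_eq φ (w₁ := w)
    (w₂ := ((x : HNNExtension G A B φ) • (empty : NormalWord d)).toReducedWord)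
    (by rw [hw, prod_smul, prod_empty, mul_one])).1
  revert key hsign
  generalize ((x : HNNExtension G A B φ) • (empty : NormalWord d)).toList = l
  have hu : (u : ℤ) * u = 1 := by rw [← Units.val_mul, Int.units_mul_self, Units.val_one]
  cases l with
  | nil => simp [w]
  | cons a l =>
    rintro ⟨h, -⟩ hsign
    have ha : a.1 = -u := by
      simp only [w, List.map_cons, List.cons.injEq] at hsign
      exact hsign.1.symm
    rw [ha] at h
    simp [hu] at h

/-! ### One letter acting forwards on `E` and backwards on `F` -/

section Biascending

universe u v

variable {E F : Type*} [Group E] [Group F] {σ : E →* E} {τ : F →* F}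

/-- The isomorphism `(e, τ f) ↦ (σ e, f)` between subgroups of `E × F`. -/
noncomputable def biascendingEquiv (hσ : Function.Injective σ) (hτ : Function.Injective τ) :
    ((MonoidHom.id E).prodMap τ).range ≃* (σ.prodMap (MonoidHom.id F)).range :=
  (MonoidHom.ofInjective (f := (MonoidHom.id E).prodMap τ)
    (Function.injective_id.prodMap hτ)).symm.trans
    (MonoidHom.ofInjective (f := σ.prodMap (MonoidHom.id F)) (hσ.prodMap Function.injective_id))

theorem t_mul_of_biascendingEquiv (hσ : Function.Injective σ) (hτ : Function.Injective τ)
    (e : E) (f : F) :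
    (t : HNNExtension (E × F) _ _ (biascendingEquiv hσ hτ)) * of (e, τ f) = of (σ e, f) * t := by
  have := t_mul_of (φ := biascendingEquiv hσ hτ)
    (MonoidHom.ofInjective (f := (MonoidHom.id E).prodMap τ)
      (Function.injective_id.prodMap hτ) (e, f))
  simp only [biascendingEquiv, MulEquiv.trans_apply, MulEquiv.symm_apply_apply] at this
  exact this

theorem not_commute_biascendingEquiv (hσ : Function.Injective σ) (hτ : Function.Injective τ)
    {x : E} {y : F} (hx : x ∉ σ.range) (hy : y ∉ τ.range) :
    ¬ Commute (of (x, 1) : HNNExtension (E × F) _ _ (biascendingEquiv hσ hτ))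
      (t * of (1, y) * t⁻¹) := by
  intro h
  have hx' : (x, (1 : F)) ∉ (σ.prodMap (MonoidHom.id F)).range := by
    rintro ⟨⟨e, f⟩, he⟩
    exact hx ⟨e, congrArg Prod.fst he⟩
  have hy' : ((1 : E), y) ∉ ((MonoidHom.id E).prodMap τ).range := by
    rintro ⟨⟨e, f⟩, he⟩
    exact hy ⟨f, congrArg Prod.snd he⟩
  -- The commutator `x · t y t⁻¹ · x⁻¹ · t y⁻¹ t⁻¹` is itself a reduced word, so it is nontrivial by
  -- Britton's lemma.
  let w : NormalWord.ReducedWord (E × F) ((MonoidHom.id E).prodMap τ).range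
      (σ.prodMap (MonoidHom.id F)).range :=
    ⟨(x, 1), [(1, (1, y)), (-1, (x⁻¹, 1)), (1, (1, y⁻¹)), (-1, 1)], by
      have h1 : (x⁻¹, (1 : F)) ∉ (σ.prodMap (MonoidHom.id F)).range := fun h => hx' <| by
        simpa using inv_mem h
      have h2 : ((1 : E), y⁻¹) ∉ ((MonoidHom.id E).prodMap τ).range := fun h => hy' <| by
        simpa using inv_mem h
      refine .cons_cons (fun h => (hy' h).elim) (.cons_cons (fun h => (h1 h).elim)
        (.cons_cons (fun h => (h2 h).elim) (.singleton _)))⟩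
  have hinv : ∀ e f, of (e⁻¹, f⁻¹) =
      (of (e, f) : HNNExtension (E × F) _ _ (biascendingEquiv hσ hτ))⁻¹ := fun e f =>
    map_inv of (e, f)
  have hw : w.prod (biascendingEquiv hσ hτ) = 1 := by
    have h1 := hinv x 1
    have h2 := hinv 1 y
    rw [inv_one] at h1 h2
    have := commutatorElement_eq_one_iff_commute.2 h
    rw [commutatorElement_def] at this
    simpa [w, NormalWord.ReducedWord.prod, h1, h2, mul_assoc] using this
  have := ReducedWord.toList_eq_nil_of_mem_of_range _ w (hw ▸ one_mem _)
  simp [w] at this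

/-- There is a group containing `E × F` in which a single letter conjugates `(e, τ f)` to `(σ e, f)`,
and does not introduce commutation beyond what this forces. -/
theorem exists_conj_eq_and_not_commute {E : Type u} {F : Type v} [Group E] [Group F] {σ : E →* E}
    {τ : F →* F} (hσ : Function.Injective σ) (hτ : Function.Injective τ) :
    ∃ (Γ : Type max u v) (_ : Group Γ) (ι : E × F →* Γ) (s : Γ),
      (∀ e f, s * ι (e, τ f) = ι (σ e, f) * s) ∧
        ∀ x ∉ σ.range, ∀ y ∉ τ.range, ¬ Commute (ι (x, 1)) (s * ι (1, y) * s⁻¹) :=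
  ⟨HNNExtension (E × F) _ _ (biascendingEquiv hσ hτ), inferInstance, of, t,
    t_mul_of_biascendingEquiv hσ hτ, fun _ hx _ hy => not_commute_biascendingEquiv hσ hτ hx hy⟩

end Biascending

end HNNExtension

/-! ### Finite generation and normal generation of kernels -/

instance Monoid.Coprod.groupFG {G H : Type*} [Group G] [Group H] [Group.FG G] [Group.FG H] :
    Group.FG (Monoid.Coprod G H) := by
  rw [Group.fg_def, ← Monoid.Coprod.range_inl_sup_range_inr]
  exact ((Group.fg_iff_subgroup_fg _).1 inferInstance).sup
    ((Group.fg_iff_subgroup_fg _).1 inferInstance)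

namespace Group.IsFinitelyPresented

theorem fg (G : Type*) [Group G] [hG : IsFinitelyPresented G] : Group.FG G := by
  obtain ⟨n, φ, hφ, -⟩ := hG
  exact Group.fg_of_surjective hφ

/-- A homomorphism from a finitely generated group onto a finitely presented group has a finitely
normally generated kernel. -/
theorem isFinitelyNormallyGenerated_ker {P G : Type*} [Group P] [Group G] [hP : Group.FG P]
    [hG : IsFinitelyPresented G] (f : P →* G) (hf : Function.Surjective f) :
    f.ker.IsFinitelyNormallyGenerated := by
  obtain ⟨n, φ, hφ, R, hR, hRφ⟩ := hG
  obtain ⟨T, hT, hTfin⟩ := Group.fg_iff.1 hP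
  choose w hw using fun p => hφ (f p)
  choose s hs using hf
  let ψ : FreeGroup (Fin n) →* P := FreeGroup.lift fun i => s (φ (FreeGroup.of i))
  have hψ : f.comp ψ = φ := by
    ext i
    simp [ψ, hs]
  have hψ' : ∀ v, f (ψ v) = φ v := fun v => DFunLike.congr_fun hψ v
  -- The lifted relators, together with relations expressing each generator of `P` through the image
  -- of `ψ`; the latter make `ψ` surjective modulo `S`.
  let S : Set P := ψ '' R ∪ (fun p => p * (ψ (w p))⁻¹) '' T
  have hker : Subgroup.normalClosure S ≤ f.ker := by
    refine Subgroup.normalClosure_le_normal ?_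
    rintro _ (⟨r, hr, rfl⟩ | ⟨p, -, rfl⟩)
    · have : r ∈ φ.ker := hRφ ▸ Subgroup.subset_normalClosure hr
      simpa [hψ'] using this
    · simp [hψ', hw]
  refine ⟨S, (hR.image _).union (hTfin.image _), le_antisymm hker ?_⟩
  have hsurj : Function.Surjective ((QuotientGroup.mk' (Subgroup.normalClosure S)).comp ψ) := by
    rw [← MonoidHom.range_eq_top, eq_top_iff,
      ← MonoidHom.range_eq_top.2 (QuotientGroup.mk'_surjective _), MonoidHom.range_eq_map, ← hT,
      MonoidHom.map_closure, Subgroup.closure_le]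
    rintro _ ⟨p, hp, rfl⟩
    refine ⟨w p, (QuotientGroup.eq_iff_div_mem.2 ?_).symm⟩
    rw [div_eq_mul_inv]
    exact Subgroup.subset_normalClosure (Or.inr ⟨p, hp, rfl⟩)
  intro p hp
  obtain ⟨v, hv⟩ := hsurj p
  have hvp : ψ v / p ∈ Subgroup.normalClosure S := QuotientGroup.eq_iff_div_mem.1 hv
  have hv1 : v ∈ φ.ker := by
    have : f (ψ v / p) = 1 := hker hvp
    rw [map_div, MonoidHom.mem_ker.1 hp, div_one, hψ'] at this
    exact this
  have hψv : ψ v ∈ Subgroup.normalClosure S := by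
    have hle : Subgroup.normalClosure R ≤ (Subgroup.normalClosure S).comap ψ :=
      Subgroup.normalClosure_le_normal fun r hr =>
        Subgroup.subset_normalClosure (Or.inl ⟨r, hr, rfl⟩)
    exact hle (hRφ ▸ hv1)
  have := mul_mem (inv_mem hvp) hψv
  simpa using this

/-- If the kernel of a homomorphism onto a finitely presented group is the normal closure of a
directed union, it is the normal closure of a member of the union. -/
theorem exists_ker_le_normalClosure {P G : Type*} [Group P] [Group G] [Group.FG P]
    [IsFinitelyPresented G] (f : P →* G) (hf : Function.Surjective f) {S : ℕ → Set P}
    (hS : Monotone S) (hker : f.ker ≤ Subgroup.normalClosure (⋃ n, S n)) :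
    ∃ n, f.ker ≤ Subgroup.normalClosure (S n) := by
  obtain ⟨R, hR, hRf⟩ := isFinitelyNormallyGenerated_ker f hf
  have hmono : Monotone fun n => Subgroup.normalClosure (S n) := fun m n h =>
    Subgroup.normalClosure_mono (hS h)
  have hmem : ∀ r ∈ R, ∃ n, r ∈ Subgroup.normalClosure (S n) := by
    intro r hr
    have hle : Subgroup.normalClosure (⋃ n, S n) ≤ ⨆ n, Subgroup.normalClosure (S n) :=
      Subgroup.normalClosure_le_normal (Set.iUnion_subset fun n =>
        Subgroup.subset_normalClosure.trans
          (le_iSup (fun n => Subgroup.normalClosure (S n)) n))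
    exact (Subgroup.mem_iSup_of_directed hmono.directed_le).1
      (hle (hker (hRf ▸ Subgroup.subset_normalClosure hr)))
  choose! m hm using hmem
  obtain ⟨n, hn⟩ := (hR.image m).bddAbove
  refine ⟨n, hRf ▸ Subgroup.normalClosure_le_normal fun r hr => ?_⟩
  exact hmono (hn ⟨r, hr, rfl⟩) (hm r hr)

end Group.IsFinitelyPresented

/-! ### Presenting the fibre product as a quotient of the free product -/

namespace FibreHNN

open HNNExtension Monoid
open scoped commutatorElement

section Kernel

variable {B : Type*} [Group B] {H K : Subgroup B} (φ : H ≃* K)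

/-- Every element of the kernel of `toCyclic φ` is a product of conjugates of base elements by powers
of the stable letter. -/
theorem ker_toCyclic_le :
    (toCyclic φ).ker ≤ Subgroup.closure {x | ∃ (k : ℤ) (b : B), x = t ^ k * of b * (t ^ k)⁻¹} := by
  set N : Subgroup (HNN φ) :=
    Subgroup.closure {x | ∃ (k : ℤ) (b : B), x = t ^ k * of b * (t ^ k)⁻¹}
  have hconj : ∀ (k : ℤ), ∀ x ∈ N, t ^ k * x * (t ^ k)⁻¹ ∈ N := by
    intro k
    suffices N ≤ N.comap (MulAut.conj (t ^ k)).toMonoidHom from fun x hx => this hx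
    refine (Subgroup.closure_le _).2 ?_
    rintro _ ⟨l, b, rfl⟩
    refine Subgroup.subset_closure ⟨k + l, b, ?_⟩
    change t ^ k * _ * (t ^ k)⁻¹ = _
    simp [zpow_add, mul_assoc]
  -- Dividing off the power of `t` gives a statement about all elements, which can be proved by
  -- induction.
  have key : ∀ a : HNN φ, a * (t ^ (toCyclic φ a).toAdd)⁻¹ ∈ N := by
    intro a
    induction a using HNNExtension.induction_on with
    | of b => simpa using (Subgroup.subset_closure ⟨0, b, by simp⟩ : of b ∈ N)
    | t => simp
    | mul x y hx hy =>
      have := mul_mem hx (hconj (toCyclic φ x).toAdd _ hy)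
      simpa [zpow_add, mul_assoc] using this
    | inv x hx =>
      have := hconj (-(toCyclic φ x).toAdd) _ (inv_mem hx)
      simpa [mul_assoc] using this
  intro a ha
  simpa [MonoidHom.mem_ker.1 ha] using key a

end Kernel

section Fibre

universe u v

variable {B₁ : Type u} {B₂ : Type v} [Group B₁] [Group B₂] {H₁ K₁ : Subgroup B₁} {H₂ K₂ : Subgroup B₂}
  (φ₁ : H₁ ≃* K₁) (φ₂ : H₂ ≃* K₂)

/-- The homomorphism from the free product of two HNN extensions to their fibre product that
restricts to `a ↦ (a, t ^ q₁ a)` and `a ↦ (t ^ q₂ a, a)`. -/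
def coprodToFibre :
    Coprod (HNN φ₁) (HNN φ₂) →* fibreProduct (toCyclic φ₁) (toCyclic φ₂) :=
  Coprod.lift
    (((MonoidHom.id _).prod ((zpowersHom (HNN φ₂) t).comp (toCyclic φ₁))).codRestrict _ fun a =>
      mem_fibreProduct.2 <| by simp [← ofAdd_zsmul])
    ((((zpowersHom (HNN φ₁) t).comp (toCyclic φ₂)).prod (MonoidHom.id _)).codRestrict _ fun a =>
      mem_fibreProduct.2 <| by simp [← ofAdd_zsmul])

@[simp]
theorem coe_coprodToFibre_inl (a : HNN φ₁) :
    (coprodToFibre φ₁ φ₂ (Coprod.inl a) : HNN φ₁ × HNN φ₂) = (a, t ^ (toCyclic φ₁ a).toAdd) := by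
  simp [coprodToFibre]

@[simp]
theorem coe_coprodToFibre_inr (a : HNN φ₂) :
    (coprodToFibre φ₁ φ₂ (Coprod.inr a) : HNN φ₁ × HNN φ₂) = (t ^ (toCyclic φ₂ a).toAdd, a) := by
  simp [coprodToFibre]

theorem coprodToFibre_surjective : Function.Surjective (coprodToFibre φ₁ φ₂) := by
  rintro ⟨⟨a₁, a₂⟩, h⟩
  have h : toCyclic φ₁ a₁ = toCyclic φ₂ a₂ := h
  -- With `k` the common image, `(a₁, a₂) = (a₁, t ^ k) (t ^ k, t ^ k)⁻¹ (t ^ k, a₂)`.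
  refine ⟨Coprod.inl a₁ * (Coprod.inl t ^ (toCyclic φ₁ a₁).toAdd)⁻¹ * Coprod.inr a₂,
    Subtype.ext ?_⟩
  simp [h]

/-- The commutator of `b₁` with the conjugate `t₂ ^ k b₂ t₂ ^ (-k)` in the free product. -/
def crossCommutator (k : ℤ) (b₁ : B₁) (b₂ : B₂) : Coprod (HNN φ₁) (HNN φ₂) :=
  ⁅(Coprod.inl (of b₁) : Coprod (HNN φ₁) (HNN φ₂)),
    (Coprod.inr (t ^ k * of b₂ * (t ^ k)⁻¹) : Coprod (HNN φ₁) (HNN φ₂))⁆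

variable {φ₁ φ₂} in
theorem map_crossCommutator_eq_one_iff {Q : Type*} [Group Q] (f : Coprod (HNN φ₁) (HNN φ₂) →* Q)
    (k : ℤ) (b₁ : B₁) (b₂ : B₂) :
    f (crossCommutator φ₁ φ₂ k b₁ b₂) = 1 ↔
      Commute (f (Coprod.inl (of b₁))) (f (Coprod.inr (t ^ k * of b₂ * (t ^ k)⁻¹))) := by
  rw [crossCommutator, map_commutatorElement, commutatorElement_eq_one_iff_commute]

/-- The relators `t₁ t₂⁻¹` and `⁅b₁, t₂ ^ k b₂ t₂ ^ (-k)⁆`, `k ≤ n`, of the fibre product. -/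
def crossRelators (n : ℕ) : Set (Coprod (HNN φ₁) (HNN φ₂)) :=
  {Coprod.inl t * (Coprod.inr t)⁻¹} ∪
    {x | ∃ (k : ℤ) (b₁ : B₁) (b₂ : B₂), k ≤ n ∧
      x = crossCommutator φ₁ φ₂ k b₁ b₂}

theorem crossRelators_mono : Monotone (crossRelators φ₁ φ₂) := by
  rintro m n h x (hx | ⟨k, b₁, b₂, hk, hx⟩)
  · exact Or.inl hx
  · exact Or.inr ⟨k, b₁, b₂, hk.trans (by exact_mod_cast h), hx⟩

theorem crossCommutator_mem_ker_coprodToFibre (k : ℤ) (b₁ : B₁) (b₂ : B₂) :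
    crossCommutator φ₁ φ₂ k b₁ b₂ ∈ (coprodToFibre φ₁ φ₂).ker := by
  rw [MonoidHom.mem_ker, map_crossCommutator_eq_one_iff]
  refine Subtype.ext ?_
  rw [Subgroup.coe_mul, Subgroup.coe_mul, coe_coprodToFibre_inl, coe_coprodToFibre_inr]
  simp

variable {φ₁ φ₂} in
/-- Homomorphisms that agree on the stable letters and under which the kernels of the maps to the
infinite cyclic group commute factor through the fibre product. -/
theorem ker_coprodToFibre_le_ker_lift {Q : Type*} [Group Q] (f₁ : HNN φ₁ →* Q) (f₂ : HNN φ₂ →* Q)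
    (ht : f₁ t = f₂ t)
    (hcomm : ∀ (k : ℤ) b₁ b₂, Commute (f₁ (of b₁)) (f₂ (t ^ k * of b₂ * (t ^ k)⁻¹))) :
    (coprodToFibre φ₁ φ₂).ker ≤ (Coprod.lift f₁ f₂).ker := by
  have hgen : ∀ (k l : ℤ) b₁ b₂, Commute (f₁ (t ^ k * of b₁ * (t ^ k)⁻¹))
      (f₂ (t ^ l * of b₂ * (t ^ l)⁻¹)) := by
    intro k l b₁ b₂
    -- Conjugating by the common image of the stable letters reduces to an unshifted `b₁`.
    have := (Commute.conj_iff (f₂ t ^ k)).2 (hcomm (l - k) b₁ b₂)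
    convert! this using 1
    · simp [ht]
    · have hl : (t : HNN φ₂) ^ l = t ^ k * t ^ (l - k) := by rw [← zpow_add, add_sub_cancel]
      rw [hl]
      simp [mul_assoc]
  have hker : ∀ x ∈ (toCyclic φ₁).ker, ∀ y ∈ (toCyclic φ₂).ker, Commute (f₁ x) (f₂ y) := by
    intro x hx y hy
    replace hx := ker_toCyclic_le φ₁ hx
    replace hy := ker_toCyclic_le φ₂ hy
    induction hx using Subgroup.closure_induction with
    | mem x hx =>
      obtain ⟨k, b₁, rfl⟩ := hx
      induction hy using Subgroup.closure_induction with
      | mem y hy =>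
        obtain ⟨l, b₂, rfl⟩ := hy
        exact hgen k l b₁ b₂
      | one => simp
      | mul y z _ _ hy hz => simpa only [map_mul] using hy.mul_right hz
      | inv y _ hy => simpa only [map_inv] using hy.inv_right
    | one => simp
    | mul y z _ _ hy hz => simpa only [map_mul] using hy.mul_left hz
    | inv y _ hy => simpa only [map_inv] using hy.inv_left
  let z : Multiplicative ℤ →* Q := zpowersHom Q (f₁ t)
  have hz₁ : ∀ k : Multiplicative ℤ, f₁ (t ^ k.toAdd) = z k := fun k => by simp [z]
  have hz₂ : ∀ k : Multiplicative ℤ, f₂ (t ^ k.toAdd) = z k := fun k => by simp [z, ht]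
  -- The same factorization of `(a₁, a₂)` forces this formula; it is multiplicative because the
  -- images of the two kernels commute.
  let g : fibreProduct (toCyclic φ₁) (toCyclic φ₂) →* Q :=
    MonoidHom.mk' (fun a => f₁ a.1.1 * (z (toCyclic φ₁ a.1.1))⁻¹ * f₂ a.1.2) <| by
      rintro ⟨⟨a₁, a₂⟩, ha⟩ ⟨⟨b₁, b₂⟩, hb⟩
      have ha : toCyclic φ₁ a₁ = toCyclic φ₂ a₂ := ha
      have h := hker (b₁ * (t ^ (toCyclic φ₁ b₁).toAdd)⁻¹)
        (by simp [MonoidHom.mem_ker, ← ofAdd_zsmul])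
        ((t ^ (toCyclic φ₁ a₁).toAdd)⁻¹ * a₂) (by simp [MonoidHom.mem_ker, ← ofAdd_zsmul, ha])
      rw [map_mul, map_mul, map_inv, map_inv, hz₁, hz₂] at h
      calc f₁ (a₁ * b₁) * (z (toCyclic φ₁ (a₁ * b₁)))⁻¹ * f₂ (a₂ * b₂)
          = f₁ a₁ * ((f₁ b₁ * (z (toCyclic φ₁ b₁))⁻¹) * ((z (toCyclic φ₁ a₁))⁻¹ * f₂ a₂)) *
              f₂ b₂ := by simp only [map_mul, mul_inv_rev, mul_assoc]
        _ = _ := by rw [h.eq]; simp only [mul_assoc]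
  have hg : g.comp (coprodToFibre φ₁ φ₂) = Coprod.lift f₁ f₂ := by
    refine Coprod.hom_ext ?_ ?_
    · ext a
      · simp [g]
      · simp [g, z, ht]
    · ext a
      · simp [g]
      · simp [g, z, ht]
  intro p hp
  rw [← hg, MonoidHom.mem_ker, MonoidHom.comp_apply, MonoidHom.mem_ker.1 hp, map_one]

theorem ker_coprodToFibre_le :
    (coprodToFibre φ₁ φ₂).ker ≤ Subgroup.normalClosure (⋃ n, crossRelators φ₁ φ₂ n) := by
  set M := Subgroup.normalClosure (⋃ n, crossRelators φ₁ φ₂ n)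
  have hmem : ∀ n, ∀ x ∈ crossRelators φ₁ φ₂ n, QuotientGroup.mk' M x = 1 := fun n x hx =>
    (QuotientGroup.eq_one_iff x).2 (Subgroup.subset_normalClosure (Set.mem_iUnion.2 ⟨n, hx⟩))
  have := ker_coprodToFibre_le_ker_lift ((QuotientGroup.mk' M).comp Coprod.inl)
    ((QuotientGroup.mk' M).comp Coprod.inr)
    (by
      have := hmem 0 (Coprod.inl t * (Coprod.inr t)⁻¹) (Or.inl rfl)
      rwa [map_mul, map_inv, mul_inv_eq_one] at this)
    (fun k b₁ b₂ => by
      -- The stages bound `k` only from above, so every negative `k` already occurs at stage `0`.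
      have := hmem k.toNat (crossCommutator φ₁ φ₂ k b₁ b₂) (Or.inr ⟨k, b₁, b₂, Int.self_le_toNat k, rfl⟩)
      rwa [map_crossCommutator_eq_one_iff] at this)
  rwa [← Coprod.comp_lift, Coprod.lift_inl_inr, MonoidHom.comp_id, QuotientGroup.ker_mk'] at this

/-! ### No stage of the relators suffices -/

variable {φ₁ φ₂} in
/-- Two HNN extensions with a common stable letter in a group where the conjugates of the second base
by nonpositive powers of the stable letter commute with the first base, but the conjugate by the
stable letter does not. -/
theorem exists_commute_and_not_commute (hφ₁ : ¬ IsAscending φ₁) (hφ₂ : ¬ IsAscending φ₂) :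
    ∃ (Γ : Type max u v) (_ : Group Γ) (f₁ : HNN φ₁ →* Γ) (f₂ : HNN φ₂ →* Γ), f₁ t = f₂ t ∧
      (∀ (m : ℕ) (b₁ : B₁) (b₂ : B₂),
        Commute (f₁ (of b₁)) (f₂ ((t ^ m)⁻¹ * of b₂ * t ^ m))) ∧
      ∃ (b₁ : B₁) (b₂ : B₂), ¬ Commute (f₁ (of b₁)) (f₂ (t * of b₂ * t⁻¹)) := by
  -- Opposite directions let the single letter `s` induce `σ` on `E` and the inverse of `τ` on the
  -- image of `τ` in `F`.
  have hσ := rayShift_injective φ₁.symm 1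
  have hτ := rayShift_injective φ₂.symm (-1)
  set σ := rayShift φ₁.symm 1 with hσdef
  set τ := rayShift φ₂.symm (-1) with hτdef
  obtain ⟨x, hx⟩ : ∃ x, x ∉ H₁ := by
    by_contra! h
    exact hφ₁ (Or.inl ((Subgroup.eq_top_iff' _).2 h))
  obtain ⟨y, hy⟩ : ∃ y, y ∉ K₂ := by
    by_contra! h
    exact hφ₂ (Or.inr ((Subgroup.eq_top_iff' _).2 h))
  have hx' : rayOf φ₁.symm 1 x ∉ σ.range := fun h => hx (mem_toSubgroup_of_mem_range_rayShift _ h)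
  have hy' : rayOf φ₂.symm (-1) y ∉ τ.range := fun h => hy <| by
    simpa using mem_toSubgroup_of_mem_range_rayShift _ h
  obtain ⟨Γ, _, ι, s, ht, hnc⟩ := exists_conj_eq_and_not_commute hσ hτ
  have hσK : ∀ k : K₁, σ (rayOf φ₁.symm 1 k) = rayOf φ₁.symm 1 (φ₁.symm k) := fun k =>
    Subtype.ext <| by simp [hσdef, equiv_eq_conj]
  have hτK : ∀ k : K₂, τ (rayOf φ₂.symm (-1) (φ₂.symm k)) = rayOf φ₂.symm (-1) k := fun k =>
    Subtype.ext <| by simp [hτdef, equiv_eq_conj, mul_assoc]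
  let f₁ : HNN φ₁ →* Γ := HNNExtension.lift
    ((ι.comp (MonoidHom.inl _ _)).comp (rayOf φ₁.symm 1)) s fun k => by
      have := ht (rayOf φ₁.symm 1 k) 1
      rwa [map_one, hσK] at this
  let f₂ : HNN φ₂ →* Γ := HNNExtension.lift
    ((ι.comp (MonoidHom.inr _ _)).comp (rayOf φ₂.symm (-1))) s fun k => by
      have := ht 1 (rayOf φ₂.symm (-1) (φ₂.symm k))
      rwa [map_one, hτK] at this
  have hf₁t : f₁ t = s := lift_t _ _ _
  have hf₂t : f₂ t = s := lift_t _ _ _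
  have hf₁ : ∀ b, f₁ (of b) = ι (rayOf φ₁.symm 1 b, 1) := fun b => lift_of _ _ _ b
  have hf₂ : ∀ b, f₂ (of b) = ι (1, rayOf φ₂.symm (-1) b) := fun b => lift_of _ _ _ b
  refine ⟨Γ, inferInstance, f₁, f₂, hf₁t.trans hf₂t.symm, fun m b₁ b₂ => ?_, x, y, ?_⟩
  · have hpow : ∀ m : ℕ, ∀ f, (s ^ m)⁻¹ * ι (1, f) * s ^ m = ι (1, τ^[m] f) := by
      intro m
      induction m with
      | zero => simp
      | succ m ih =>
        intro f
        have h1 : s⁻¹ * ι (1, f) * s = ι (1, τ f) := by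
          have := ht 1 f
          rw [map_one] at this
          rw [mul_assoc, ← this, inv_mul_cancel_left]
        rw [Function.iterate_succ_apply, ← ih, ← h1, pow_succ']
        simp [mul_assoc]
    have h2 : f₂ ((t ^ m)⁻¹ * of b₂ * t ^ m) = ι (1, τ^[m] (rayOf φ₂.symm (-1) b₂)) := by
      rw [← hpow, map_mul, map_mul, map_inv, map_pow, hf₂t, hf₂]
    rw [hf₁, h2]
    exact Commute.map (by simp [Commute, SemiconjBy]) ι
  · rw [map_mul, map_mul, map_inv, hf₂t, hf₁, hf₂]
    exact hnc _ hx' _ hy'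

theorem not_ker_coprodToFibre_le (hφ₁ : ¬ IsAscending φ₁) (hφ₂ : ¬ IsAscending φ₂) (n : ℕ) :
    ¬ (coprodToFibre φ₁ φ₂).ker ≤ Subgroup.normalClosure (crossRelators φ₁ φ₂ n) := by
  intro hle
  obtain ⟨Γ, _, f₁, f₂, ht, hcomm, x, y, hxy⟩ := exists_commute_and_not_commute hφ₁ hφ₂
  -- Precomposing `f₂` with conjugation by `t ^ (-n)` shifts the exponent `k` to `k - n`: relators
  -- with `k ≤ n` die, while `k = n + 1` becomes the surviving exponent `1`. The relator `t₁ t₂⁻¹`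
  -- is unaffected since this conjugation fixes `t`.
  let F : Coprod (HNN φ₁) (HNN φ₂) →* Γ :=
    Coprod.lift f₁ (f₂.comp (MulAut.conj ((t ^ n)⁻¹ : HNN φ₂)).toMonoidHom)
  have hF₁ : ∀ a, F (Coprod.inl a) = f₁ a := fun a => by simp [F]
  have hF₂ : ∀ a, F (Coprod.inr a) = f₂ ((t ^ n)⁻¹ * a * t ^ n) := fun a => by
    change Coprod.lift _ _ (Coprod.inr a) = _
    rw [Coprod.lift_apply_inr, MonoidHom.comp_apply]
    change f₂ ((t ^ n)⁻¹ * a * ((t ^ n)⁻¹)⁻¹) = _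
    rw [inv_inv]
  have hF : Subgroup.normalClosure (crossRelators φ₁ φ₂ n) ≤ F.ker := by
    refine Subgroup.normalClosure_le_normal ?_
    rintro _ (rfl | ⟨k, b₁, b₂, hk, rfl⟩)
    · have : ((t : HNN φ₂) ^ n)⁻¹ * t * t ^ n = t := by
        rw [mul_assoc, ← pow_succ', pow_succ, inv_mul_cancel_left]
      change F _ = 1
      rw [map_mul, map_inv, hF₁, hF₂, this, ht, mul_inv_cancel]
    · change F _ = 1
      rw [map_crossCommutator_eq_one_iff, hF₁, hF₂]
      obtain ⟨m, hm⟩ := Int.eq_ofNat_of_zero_le (sub_nonneg.2 hk)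
      obtain rfl : k = n - m := by omega
      convert! hcomm m b₁ b₂ using 2
      simp [zpow_sub, mul_assoc]
  have h := hF (hle (crossCommutator_mem_ker_coprodToFibre φ₁ φ₂ (n + 1) x y))
  rw [MonoidHom.mem_ker, map_crossCommutator_eq_one_iff, hF₁, hF₂] at h
  refine hxy ?_
  convert! h using 2
  simp [zpow_add, mul_assoc]

end Fibre

instance {B : Type*} [Group B] [Group.FG B] {H K : Subgroup B} (φ : H ≃* K) :
    Group.FG (HNN φ) :=
  Group.fg_of_surjective (f := (HNNExtension.con B K H φ.symm).mk') Con.mk'_surjective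

end FibreHNN

theorem mainTheorem10 {B₁ B₂ : Type*} [Group B₁] [Group B₂]
    [Group.IsFinitelyPresented B₁] [Group.IsFinitelyPresented B₂]
    {H₁ K₁ : Subgroup B₁} {H₂ K₂ : Subgroup B₂}
    (φ₁ : H₁ ≃* K₁) (φ₂ : H₂ ≃* K₂)
    (hH₁ : H₁.FG) (hH₂ : H₂.FG)
    (hφ₁ : ¬ FibreHNN.IsAscending φ₁) (hφ₂ : ¬ FibreHNN.IsAscending φ₂) :
    Group.FG (FibreHNN.fibreProduct (FibreHNN.toCyclic φ₁) (FibreHNN.toCyclic φ₂)) ∧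
      ¬ Group.IsFinitelyPresented
        (FibreHNN.fibreProduct (FibreHNN.toCyclic φ₁) (FibreHNN.toCyclic φ₂)) := by
  have hsurj := FibreHNN.coprodToFibre_surjective φ₁ φ₂
  have := Group.IsFinitelyPresented.fg B₁
  have := Group.IsFinitelyPresented.fg B₂
  have hfg : Group.FG (Monoid.Coprod (FibreHNN.HNN φ₁) (FibreHNN.HNN φ₂)) := inferInstance
  refine ⟨Group.fg_of_surjective hsurj, fun hfp => ?_⟩
  obtain ⟨n, hn⟩ := Group.IsFinitelyPresented.exists_ker_le_normalClosure _ hsurj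
    (FibreHNN.crossRelators_mono φ₁ φ₂) (FibreHNN.ker_coprodToFibre_le φ₁ φ₂)
  exact FibreHNN.not_ker_coprodToFibre_le φ₁ φ₂ hφ₁ hφ₂ n hn
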